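/- Let $\tau$ be a countable vocabulary and let $K$ be a universal class of $\tau$-structures, i.e. a class of $\tau$-structures closed under isomorphisms, under substructures, and under unions of nonempty $\subseteq$-increasing chains. Assume that $K$ is categorical in $\aleph_0$, i.e. $K$ has, up to isomorphism, exactly one member of cardinality $\aleph_0$. Then for all infinite $M, N \in K$, $M$ is a substructure of $N$ if and only if $M$ is an $\mathbb{L}_{\infty,\omega}$-elementary substructure of $N$. Moreover, there is a single $\mathbb{L}_{\omega_1,\omega}$-sentence $\phi$ whose models are exactly the infinite members of $K$. (In particular, $\phi$ is a Scott sentence of the countably infinite member $M_0$ of $K$: its countable models are exactly the structures isomorphic to $M_0$.) -/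

import Mathlib

open FirstOrder CategoryTheory

universe u v w w' x

namespace FirstOrder.Language

/-- Formulas of the infinitary logic `𝕃_{∞,ω}` over the language `L`, with free variables among
`x₀, …, x_{n-1}`. Conjunctions are indexed by arbitrary types (of an arbitrary universe `x`) and
quantification is over single variables; `ex φ` binds the last variable of `φ`. Disjunction and the
universal quantifier are obtained from these through negation. -/
inductive InfFormula (L : Language.{u, v}) : ℕ → Type (max u v (x + 1))
  | equal {n : ℕ} (t₁ t₂ : L.Term (Fin n)) : InfFormula L n
  | rel {n l : ℕ} (R : L.Relations l) (ts : Fin l → L.Term (Fin n)) : InfFormula L n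
  | neg {n : ℕ} (φ : InfFormula L n) : InfFormula L n
  | conj {n : ℕ} {ι : Type x} (φ : ι → InfFormula L n) : InfFormula L n
  | ex {n : ℕ} (φ : InfFormula L (n + 1)) : InfFormula L n

/-- Sentences of `𝕃_{∞,ω}`. -/
abbrev InfSentence (L : Language.{u, v}) : Type (max u v (x + 1)) := InfFormula.{u, v, x} L 0

namespace InfFormula

variable {L : Language.{u, v}}

/-- Satisfaction `M ⊨ φ(v)`. -/
def Realize {M : Type w} [L.Structure M] :
    ∀ {n : ℕ}, InfFormula.{u, v, x} L n → (Fin n → M) → Prop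
  | _, equal t₁ t₂, v => t₁.realize v = t₂.realize v
  | _, rel R ts, v => Structure.RelMap R fun i => (ts i).realize v
  | _, neg φ, v => ¬ φ.Realize v
  | _, conj φ, v => ∀ i, (φ i).Realize v
  | _, ex φ, v => ∃ a : M, φ.Realize (Fin.snoc v a : Fin _ → M)

/-- `φ` is a formula of `𝕃_{ω₁,ω}`: all conjunctions occurring in it are countable. -/
def IsLOmegaOneOmega : ∀ {n : ℕ}, InfFormula.{u, v, x} L n → Prop
  | _, equal _ _ => True
  | _, rel _ _ => True
  | _, neg φ => φ.IsLOmegaOneOmega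
  | _, @conj _ _ ι φ => Countable ι ∧ ∀ i, (φ i).IsLOmegaOneOmega
  | _, ex φ => φ.IsLOmegaOneOmega

end InfFormula

/-- The structure `M` is a model of the sentence `φ`. -/
def InfSentence.IsModel {L : Language.{u, v}} (φ : InfSentence.{u, v, x} L)
    (M : Type w) [L.Structure M] : Prop :=
  InfFormula.Realize φ (Fin.elim0 : Fin 0 → M)

/-- `φ` is a Scott sentence of the countable structure `M`: the countable models of `φ` are exactly the structures
isomorphic to `M`. -/
def InfSentence.IsScottSentenceOf {L : Language.{u, v}} (φ : InfSentence.{u, v, x} L)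
    (M : Bundled.{w} L.Structure) : Prop :=
  ∀ N : Bundled.{w} L.Structure, (Countable N ∧ φ.IsModel N) ↔ Nonempty (N ≃[L] M)

/-- The map `f : M → N` identifies `M` with a substructure of `N`. For an inclusion map between
underlying sets, this says `M ⊆ N`. -/
def IsSubstructureMap (L : Language.{u, v}) {M : Type w} {N : Type w'} [L.Structure M]
    [L.Structure N] (f : M → N) : Prop :=
  ∃ g : M ↪[L] N, ⇑g = f

/-- The map `f : M → N` preserves and reflects satisfaction of all `𝕃_{∞,ω}`-formulas. For an
inclusion map between underlying sets, this says that `M` is an `𝕃_{∞,ω}`-elementary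
substructure of `N`. -/
def IsInfElementaryMap (L : Language.{u, v}) {M : Type w} {N : Type w'} [L.Structure M]
    [L.Structure N] (f : M → N) : Prop :=
  ∀ (n : ℕ) (φ : InfFormula.{u, v, x} L n) (a : Fin n → M),
    φ.Realize a ↔ φ.Realize (f ∘ a)

/-- Universal classes of `L`-structures. As usual in model theory, only nonempty structures
count as substructures in the last clause; whether `K` also contains structures
with empty universe is left open. -/
structure IsUniversalClass {L : Language.{u, v}} (K : Set (Bundled.{w} L.Structure)) : Prop where
  /-- `K` is closed under isomorphisms. -/
  iso_mem : ∀ M N : Bundled.{w} L.Structure, M ∈ K → Nonempty (M ≃[L] N) → N ∈ K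
  /-- `K` is closed under unions of `⊆`-increasing chains: if `N` is the union of a nonempty chain
  of substructures belonging to `K`, then `N` belongs to `K`. -/
  chain_mem : ∀ (N : Bundled.{w} L.Structure) (c : Set (L.Substructure N)), c.Nonempty →
    IsChain (· ≤ ·) c → (∀ S ∈ c, (⟨S, Substructure.inducedStructure⟩ : Bundled.{w} L.Structure) ∈ K) →
    (∀ a : N, ∃ S ∈ c, a ∈ S) → N ∈ K
  /-- `K` is closed under substructures. -/
  sub_mem : ∀ M ∈ K, ∀ S : L.Substructure M, (S : Set M).Nonempty →
    (⟨S, Substructure.inducedStructure⟩ : Bundled.{w} L.Structure) ∈ K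

/-- `K` has exactly one member of cardinality `κ`, up to isomorphism. -/
def IsCategoricalIn {L : Language.{u, v}} (K : Set (Bundled.{w} L.Structure))
    (κ : Cardinal.{w}) : Prop :=
  (∃ M ∈ K, Cardinal.mk M = κ) ∧
    ∀ M ∈ K, ∀ N ∈ K, Cardinal.mk M = κ → Cardinal.mk N = κ → Nonempty (M ≃[L] N)

end FirstOrder.Language

/-! Elementarity is a forcing argument. Call an existential formula decided at a tuple of a
countably infinite member of `K` if it holds there or fails in every countably infinite extension in
`K`. Every tuple is decided in some extension, and decisions persist upwards once the matrix is
known to be preserved. Closing off along an `ω`-chain gives a countably infinite union in which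
every tuple is decided; by categoricity it is any given countable member (`forall_of_dense`). So an
extension adds no new existential truths, and induction on formulas gives `realize_comp_embedding`;
uncountable members reduce to countable substructures.

For the axiomatization, a universal class is determined by its finitely generated members
(`closure_mem`), and the quantifier-free type of a tuple determines the substructure it generates.
With `M₀` the countable model, `φ` says that the universe is infinite and every finite tuple has a
quantifier-free type realized in `M₀`. -/

namespace FirstOrder.Language

open Cardinal

variable {L : Language.{u, v}} {K : Set (Bundled.{w} L.Structure)}

/-- The countably infinite members of `K`. -/
def countablyInfiniteMembers (K : Set (Bundled.{w} L.Structure)) : Set (Bundled.{w} L.Structure) :=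
  {M | M ∈ K ∧ #M = ℵ₀}

/-! ### Chains, categoricity and elementarity of embeddings -/

namespace IsUniversalClass

theorem range_mem (hK : IsUniversalClass K) {M : Bundled.{w} L.Structure} (hM : M ∈ K)
    {N : Type w} [L.Structure N] (g : M ↪[L] N) :
    (⟨g.toHom.range, Substructure.inducedStructure⟩ : Bundled.{w} L.Structure) ∈ K :=
  hK.iso_mem M _ hM ⟨g.equivRange⟩

theorem mem_of_embedding (hK : IsUniversalClass K) {M N : Bundled.{w} L.Structure} (hN : N ∈ K)
    [Nonempty M] (g : M ↪[L] N) : M ∈ K := by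
  refine hK.iso_mem ⟨g.toHom.range, Substructure.inducedStructure⟩ M (hK.sub_mem N hN _ ?_)
    ⟨g.equivRange.symm⟩
  exact ⟨g (Classical.arbitrary M), _, rfl⟩

/-- An increasing `ω`-chain of countably infinite members of `K` has a union in `K`, which is
again countably infinite. -/
theorem exists_union (hK : IsUniversalClass K) (M : ℕ → Bundled.{w} L.Structure)
    (hM : ∀ n, M n ∈ countablyInfiniteMembers K) (f : ∀ n, M n ↪[L] M (n + 1)) :
    ∃ N ∈ countablyInfiniteMembers K, ∃ g : ∀ n, M n ↪[L] N,
      (∀ n x, g (n + 1) (f n x) = g n x) ∧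
      ∀ (k : ℕ) (a : Fin k → N), ∃ n, ∃ b : Fin k → M n, a = g n ∘ b := by
  let F := DirectedSystem.natLERec (L := L) (G' := fun n => M n) f
  let D := DirectLimit (fun n => M n) F
  let g : ∀ n, M n ↪[L] D := fun n => DirectLimit.of L ℕ (fun n => M n) F n
  have hmono : ∀ m n, m ≤ n → (g m).toHom.range ≤ (g n).toHom.range := by
    rintro m n hmn _ ⟨y, rfl⟩
    exact ⟨F m n hmn y, DirectLimit.of_f⟩
  have htup : ∀ (k : ℕ) (a : Fin k → D), ∃ n, ∃ b : Fin k → M n, a = g n ∘ b := by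
    intro k a
    obtain ⟨n, b, rfl⟩ := DirectLimit.exists_quotient_mk'_sigma_mk'_eq _ F a
    exact ⟨n, b, rfl⟩
  have hex : ∀ z : D, ∃ n x, g n x = z := fun z => DirectLimit.exists_of z
  refine ⟨⟨D, inferInstance⟩, ⟨?_, ?_⟩, g, ?_, htup⟩
  · refine hK.chain_mem _ (Set.range fun n => (g n).toHom.range) ⟨_, 0, rfl⟩ ?_ ?_ ?_
    · rintro _ ⟨m, rfl⟩ _ ⟨n, rfl⟩ -
      rcases le_total m n with h | h
      · exact Or.inl (hmono m n h)
      · exact Or.inr (hmono n m h)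
    · rintro _ ⟨n, rfl⟩
      exact hK.range_mem (hM n).1 (g n)
    · intro z
      obtain ⟨n, x, rfl⟩ := hex z
      exact ⟨_, ⟨n, rfl⟩, x, rfl⟩
  · have hc : ∀ n, Countable (M n) := fun n => mk_le_aleph0_iff.1 (hM n).2.le
    have : Countable D := by
      refine Function.Surjective.countable (f := fun p : Σ n, M n => g p.1 p.2) fun z => ?_
      obtain ⟨n, x, h⟩ := hex z
      exact ⟨⟨n, x⟩, h⟩
    have : Infinite (M 0) := infinite_iff.2 (hM 0).2.ge
    have : Infinite D := Infinite.of_injective _ (g 0).injective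
    exact mk_eq_aleph0 D
  · intro n x
    have h : F n (n + 1) n.le_succ x = f n x := by
      simp [F, Nat.leRecOn_succ', DirectedSystem.coe_natLERec]
    rw [← h]
    exact DirectLimit.of_f

/-- Suppose that `K` is categorical in `ℵ₀`. If a property of `k`-tuples from countably infinite
members of `K` is preserved by embeddings, and any such tuple acquires the property in some
extension, then all tuples have the property. -/
theorem forall_of_dense (hK : IsUniversalClass K) (hcat : IsCategoricalIn K ℵ₀) {k : ℕ}
    (R : ∀ M : Bundled.{w} L.Structure, (Fin k → M) → Prop)
    (hR : ∀ M ∈ countablyInfiniteMembers K, ∀ N ∈ countablyInfiniteMembers K,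
      ∀ (g : M ↪[L] N) a, R M a → R N (g ∘ a))
    (hdense : ∀ M ∈ countablyInfiniteMembers K, ∀ a : Fin k → M,
      ∃ N ∈ countablyInfiniteMembers K, ∃ g : M ↪[L] N, R N (g ∘ a))
    (M : Bundled.{w} L.Structure) (hM : M ∈ countablyInfiniteMembers K) (a : Fin k → M) :
    R M a := by
  -- One extension serves all tuples of `M` at once: enumerate them and treat the `n`-th at stage
  -- `n` of a chain.
  have step : ∀ M : countablyInfiniteMembers K, ∃ N : countablyInfiniteMembers K,
      ∃ g : M.1 ↪[L] N.1, ∀ a, R N.1 (g ∘ a) := by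
    rintro ⟨M, hM⟩
    have : Countable M := mk_le_aleph0_iff.1 hM.2.le
    have : Infinite M := infinite_iff.2 hM.2.ge
    obtain ⟨e, he⟩ := exists_surjective_nat (Fin k → M)
    choose N hN g hg using hdense
    -- Each stage carries its embedding of `M`, to locate the tuples still to be treated.
    let S := Σ P : countablyInfiniteMembers K, M ↪[L] P.1
    let next : ℕ → S → S := fun n s =>
      ⟨⟨N s.1.1 s.1.2 (s.2 ∘ e n), hN _ _ _⟩, (g s.1.1 s.1.2 (s.2 ∘ e n)).comp s.2⟩
    let c : ℕ → S := fun n => Nat.rec ⟨⟨M, hM⟩, Embedding.refl L M⟩ next n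
    obtain ⟨U, hU, i, hi, -⟩ := hK.exists_union (fun n => (c n).1.1) (fun n => (c n).1.2)
      (fun n => g (c n).1.1 (c n).1.2 ((c n).2 ∘ e n))
    have hcomm : ∀ n x, i n ((c n).2 x) = i 0 x := by
      intro n
      induction n with
      | zero => exact fun x => rfl
      | succ n ih => exact fun x => (hi n ((c n).2 x)).trans (ih x)
    refine ⟨⟨U, hU⟩, i 0, fun a => ?_⟩
    obtain ⟨n, rfl⟩ := he a
    have h := hR _ (c (n + 1)).1.2 U hU (i (n + 1)) _ (hg (c n).1.1 (c n).1.2 ((c n).2 ∘ e n))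
    convert h using 1
    funext j
    exact (hcomm (n + 1) (e n j)).symm
  choose N g hg using step
  -- Iterating catches the tuples added on the way: a tuple of the union comes from some stage `n`
  -- and has `R` from stage `n + 1` on.
  let c : ℕ → countablyInfiniteMembers K := fun n => N^[n] ⟨M, hM⟩
  have hc : ∀ n, c (n + 1) = N (c n) := fun n => Function.iterate_succ_apply' N n _
  have hs : ∀ n, ∃ g : (c n).1 ↪[L] (c (n + 1)).1, ∀ a, R (c (n + 1)).1 (g ∘ a) := by
    intro n
    rw [hc n]
    exact ⟨g (c n), hg (c n)⟩
  choose f hf using hs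
  obtain ⟨U, hU, i, hi, htup⟩ := hK.exists_union (fun n => (c n).1) (fun n => (c n).2) f
  obtain ⟨e⟩ := hcat.2 M hM.1 U hU.1 hM.2 hU.2
  obtain ⟨n, b, hb⟩ := htup k (e ∘ a)
  have h := hR U hU M hM e.symm.toEmbedding _ (hR _ (c (n + 1)).2 U hU (i (n + 1)) _ (hf n b))
  convert h using 1
  funext j
  have h1 : i (n + 1) (f n (b j)) = e (a j) := (hi n (b j)).trans (congrFun hb j).symm
  simp [h1]

/-- Every countable subset of an infinite member of `K` is contained in a countably infinite
substructure, which belongs to `K`. -/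
theorem exists_countable_substructure [Countable (Σ l, L.Functions l)] (hK : IsUniversalClass K)
    {M : Bundled.{w} L.Structure} (hM : M ∈ K) (hinf : ℵ₀ ≤ #M) (s : Set M) (hs : s.Countable) :
    ∃ S : L.Substructure M, s ⊆ S ∧
      (⟨S, Substructure.inducedStructure⟩ : Bundled.{w} L.Structure) ∈
        countablyInfiniteMembers K := by
  have : Infinite M := infinite_iff.2 hinf
  let e := Infinite.natEmbedding M
  let S := Substructure.closure L (s ∪ Set.range e)
  have hS : Countable S := (hs.union (Set.countable_range e)).substructure_closure L
  have hsub : s ∪ Set.range e ⊆ S := Substructure.subset_closure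
  have : Infinite S := Infinite.of_injective
    (fun n => (⟨e n, hsub (Or.inr ⟨n, rfl⟩)⟩ : S)) fun m n h => e.injective (congrArg Subtype.val h)
  exact ⟨S, Set.subset_union_left.trans hsub,
    hK.sub_mem M hM S ⟨e 0, hsub (Or.inr ⟨0, rfl⟩)⟩, mk_eq_aleph0 S⟩

/-- If `K` is categorical in `ℵ₀`, then all embeddings between infinite members of `K` preserve
and reflect `𝕃_{∞,ω}`-formulas. -/
theorem realize_comp_embedding [Countable (Σ l, L.Functions l)] (hK : IsUniversalClass K)
    (hcat : IsCategoricalIn K ℵ₀) {n : ℕ} (φ : InfFormula.{u, v, x} L n) :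
    ∀ M ∈ K, ∀ N ∈ K, ℵ₀ ≤ #M → ℵ₀ ≤ #N → ∀ (g : M ↪[L] N) (a : Fin n → M),
      φ.Realize a ↔ φ.Realize (g ∘ a) := by
  induction φ with
  | equal t₁ t₂ =>
    intro M _ N _ _ _ g a
    simp only [InfFormula.Realize, HomClass.realize_term, g.injective.eq_iff]
  | rel R ts =>
    intro M _ N _ _ _ g a
    simp only [InfFormula.Realize, HomClass.realize_term]
    exact (g.map_rel R _).symm
  | neg φ ih =>
    intro M hM N hN hM' hN' g a
    exact not_congr (ih M hM N hN hM' hN' g a)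
  | conj φ ih =>
    intro M hM N hN hM' hN' g a
    exact forall_congr' fun i => ih i M hM N hN hM' hN' g a
  | @ex n ψ ih =>
    have up : ∀ M ∈ K, ∀ N ∈ K, ℵ₀ ≤ #M → ℵ₀ ≤ #N → ∀ (g : M ↪[L] N) (a : Fin n → M),
        ψ.ex.Realize a → ψ.ex.Realize (g ∘ a) := by
      rintro M hM N hN hM' hN' g a ⟨b, hb⟩
      refine ⟨g b, ?_⟩
      rw [← Fin.comp_snoc]
      exact (ih M hM N hN hM' hN' g _).1 hb
    -- The formula is decided at `a`; density is then excluded middle.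
    let R : ∀ M : Bundled.{w} L.Structure, (Fin n → M) → Prop := fun M a =>
      ψ.ex.Realize a ∨
        ∀ N ∈ countablyInfiniteMembers K, ∀ g : M ↪[L] N, ¬ ψ.ex.Realize (g ∘ a)
    have key := hK.forall_of_dense hcat R ?_ ?_
    · intro M hM N hN hM' hN' g a
      refine ⟨up M hM N hN hM' hN' g a, ?_⟩
      rintro ⟨b, hb⟩
      -- Descend to countable `S` and `T`, where `T` contains the image of `S` and the witness `b`.
      -- The formula holds in `T`, which excludes the negative decision at `a` in `S`.
      obtain ⟨S, haS, hS⟩ := hK.exists_countable_substructure hM hM' (Set.range a)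
        (Set.countable_range a)
      have hSc : Set.Countable (S : Set M) := mk_le_aleph0_iff.1 hS.2.le
      obtain ⟨T, hT', hT⟩ := hK.exists_countable_substructure hN hN' (insert b (g '' S))
        ((hSc.image g).insert b)
      let a' : Fin n → S := fun i => ⟨a i, haS ⟨i, rfl⟩⟩
      let g' : S ↪[L] T := (g.comp S.subtype).codRestrict T
        fun s => hT' (Or.inr ⟨s, s.2, rfl⟩)
      have hb' : ψ.ex.Realize (g' ∘ a') := by
        refine ⟨⟨b, hT' (Or.inl rfl)⟩, ?_⟩
        refine (ih _ hT.1 N hN hT.2.ge hN' T.subtype _).2 ?_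
        rw [Fin.comp_snoc]
        exact hb
      have ha' : ψ.ex.Realize a' :=
        (key _ hS a').resolve_right fun h => h _ hT g' hb'
      exact up _ hS.1 M hM hS.2.ge hM' S.subtype a' ha'
    · rintro M hM N hN g a (h | h)
      · exact Or.inl (up M hM.1 N hN.1 hM.2.ge hN.2.ge g a h)
      · exact Or.inr fun P hP i => h P hP (i.comp g)
    · intro M hM a
      by_cases h : ∃ N ∈ countablyInfiniteMembers K, ∃ g : M ↪[L] N, ψ.ex.Realize (g ∘ a)
      · obtain ⟨N, hN, g, h⟩ := h
        exact ⟨N, hN, g, Or.inl h⟩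
      · push Not at h
        exact ⟨M, hM, Embedding.refl L M, Or.inr h⟩

end IsUniversalClass

/-- Atomic formulas suffice: equality of two variables gives injectivity, and the graph of `F`, with
the value as last variable, gives preservation of functions. -/
theorem IsInfElementaryMap.isSubstructureMap {M : Type w} {N : Type w'} [L.Structure M]
    [L.Structure N] {f : M → N} (hf : IsInfElementaryMap.{u, v, w, w', x} L f) :
    IsSubstructureMap L f := by
  refine ⟨⟨⟨f, fun a b hab => ?_⟩, fun {n} F a => ?_, fun {n} R a => ?_⟩, rfl⟩
  · exact (hf 2 (.equal (.var 0) (.var 1)) ![a, b]).2 (by simpa [InfFormula.Realize] using hab)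
  · have h := (hf (n + 1) (.equal (.var (Fin.last n)) (.func F fun i => .var i.castSucc))
      (Fin.snoc a (Structure.funMap F a))).1 (by simp [InfFormula.Realize])
    rw [Fin.comp_snoc] at h
    simp only [InfFormula.Realize, Term.realize_var, Term.realize_func, Fin.snoc_last,
      Fin.snoc_castSucc] at h
    exact h
  · have h := hf n (.rel R fun i => .var i) a
    simp only [InfFormula.Realize, Term.realize_var] at h
    exact h.symm

/-! ### Reduction to finitely generated substructures -/

/-- A structure belongs to a universal class if its finitely generated nonempty substructures do;
this is the version for the substructure generated by a set `X`. -/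
theorem IsUniversalClass.closure_mem (hK : IsUniversalClass K) {M : Bundled.{w} L.Structure}
    (hfin : ∀ X : Set M, X.Finite → X.Nonempty →
      (⟨Substructure.closure L X, Substructure.inducedStructure⟩ : Bundled.{w} L.Structure) ∈ K) :
    ∀ X : Set M, X.Nonempty →
      (⟨Substructure.closure L X, Substructure.inducedStructure⟩ : Bundled.{w} L.Structure) ∈ K := by
  suffices ∀ (κ : Cardinal.{w}) (X : Set M), #X = κ → X.Nonempty →
      (⟨Substructure.closure L X, Substructure.inducedStructure⟩ : Bundled.{w} L.Structure) ∈ K from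
    fun X => this _ X rfl
  intro κ
  induction κ using WellFoundedLT.induction with
  | ind κ ih =>
  rintro X rfl hX
  rcases lt_or_ge #X ℵ₀ with h | h
  · exact hfin X (lt_aleph0_iff_set_finite.1 h) hX
  -- In a well-order of least possible type, each closed initial segment of the infinite set `X` is
  -- smaller than `X`. The closures of these segments form a chain with union the closure of `X`.
  obtain ⟨_, _, hord⟩ := exists_ord_eq_type_lt X
  have : Nonempty X := hX.to_subtype
  let T : X → Set M := fun i => (↑) '' Set.Iic i
  have hTX : ∀ i, T i ⊆ X := by
    rintro i _ ⟨j, -, rfl⟩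
    exact j.2
  have hTmono : ∀ i j, i ≤ j → T i ⊆ T j := fun i j hij => Set.image_mono (Set.Iic_subset_Iic.2 hij)
  have hTcard : ∀ i, #(T i) < #X := fun i => mk_image_le.trans_lt (mk_Iic_lt i hord h)
  have hle : ∀ i, Substructure.closure L (T i) ≤ Substructure.closure L X :=
    fun i => Substructure.closure_mono (hTX i)
  let S : X → L.Substructure (Substructure.closure L X) := fun i =>
    (Substructure.inclusion (hle i)).toHom.range
  have hSmono : ∀ i j, i ≤ j → S i ≤ S j := by
    rintro i j hij _ ⟨y, rfl⟩
    exact ⟨⟨y, Substructure.closure_mono (hTmono i j hij) y.2⟩, rfl⟩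
  refine hK.chain_mem _ (Set.range S) (Set.range_nonempty S) ?_ ?_ ?_
  · rintro _ ⟨i, rfl⟩ _ ⟨j, rfl⟩ -
    exact (le_total i j).imp (hSmono i j) (hSmono j i)
  · rintro _ ⟨i, rfl⟩
    exact hK.range_mem (ih _ (hTcard i) (T i) rfl ⟨i, i, le_refl i, rfl⟩)
      (Substructure.inclusion (hle i))
  · rintro ⟨y, hy⟩
    have hdir : Directed (· ≤ ·) fun i => Substructure.closure L (T i) :=
      Monotone.directed_le fun i j hij => Substructure.closure_mono (hTmono i j hij)
    have hX' : X = ⋃ i, T i := by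
      refine Set.Subset.antisymm (fun x hx => Set.mem_iUnion.2 ⟨⟨x, hx⟩, ⟨x, hx⟩, le_refl _, rfl⟩) ?_
      exact Set.iUnion_subset hTX
    have hy' := hy
    rw [hX', Substructure.closure_iUnion, Substructure.mem_iSup_of_directed hdir] at hy'
    obtain ⟨i, hi⟩ := hy'
    exact ⟨S i, ⟨i, rfl⟩, ⟨y, hi⟩, rfl⟩

theorem IsUniversalClass.mem_of_forall_closure_mem (hK : IsUniversalClass K)
    {M : Bundled.{w} L.Structure} [Nonempty M]
    (hfin : ∀ X : Set M, X.Finite → X.Nonempty →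
      (⟨Substructure.closure L X, Substructure.inducedStructure⟩ : Bundled.{w} L.Structure) ∈ K) :
    M ∈ K := by
  refine hK.iso_mem _ M (hK.closure_mem hfin Set.univ Set.univ_nonempty) ?_
  rw [Substructure.closure_univ]
  exact ⟨Substructure.topEquiv⟩

instance countable_relations [Countable L.Symbols] : Countable (Σ l, L.Relations l) :=
  (Sum.inr_injective (α := Σ l, L.Functions l)).countable

/-! ### Countable connectives and quantifier-free types -/

namespace InfFormula

section Connectives

variable {n : ℕ} {M : Type w} [L.Structure M]

/-- The conjunction of a family of formulas indexed by a countable type of any universe. -/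
noncomputable def countableConj {α : Type w'} [Countable α] (φ : α → InfFormula.{u, v, x} L n) :
    InfFormula.{u, v, x} L n :=
  conj fun i : Shrink.{x} α => φ ((equivShrink.{x} α).symm i)

theorem isLOmegaOneOmega_countableConj {α : Type w'} [Countable α]
    {φ : α → InfFormula.{u, v, x} L n} (h : ∀ i, (φ i).IsLOmegaOneOmega) :
    (countableConj φ).IsLOmegaOneOmega :=
  ⟨(equivShrink.{x} α).symm.countable_iff.2 inferInstance, fun _ => h _⟩

@[simp]
theorem realize_countableConj {α : Type w'} [Countable α] {φ : α → InfFormula.{u, v, x} L n}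
    {v : Fin n → M} : (countableConj φ).Realize v ↔ ∀ i, (φ i).Realize v :=
  (equivShrink.{x} α).symm.forall_congr_left.trans (by simp)

/-- The disjunction of a family of formulas indexed by a countable type of any universe. -/
noncomputable def countableDisj {α : Type w'} [Countable α] (φ : α → InfFormula.{u, v, x} L n) :
    InfFormula.{u, v, x} L n :=
  neg (countableConj fun i => neg (φ i))

theorem isLOmegaOneOmega_countableDisj {α : Type w'} [Countable α]
    {φ : α → InfFormula.{u, v, x} L n} (h : ∀ i, (φ i).IsLOmegaOneOmega) :
    (countableDisj φ).IsLOmegaOneOmega :=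
  isLOmegaOneOmega_countableConj (φ := fun i => neg (φ i)) h

@[simp]
theorem realize_countableDisj {α : Type w'} [Countable α] {φ : α → InfFormula.{u, v, x} L n}
    {v : Fin n → M} : (countableDisj φ).Realize v ↔ ∃ i, (φ i).Realize v := by
  simp [countableDisj, Realize]

/-- Existential quantification over all free variables. -/
def exs : ∀ {n : ℕ}, InfFormula.{u, v, x} L n → InfSentence.{u, v, x} L
  | 0, φ => φ
  | _ + 1, φ => exs (ex φ)

theorem isLOmegaOneOmega_exs : ∀ {n : ℕ} {φ : InfFormula.{u, v, x} L n},
    φ.IsLOmegaOneOmega → φ.exs.IsLOmegaOneOmega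
  | 0, _, h => h
  | _ + 1, φ, h => isLOmegaOneOmega_exs (φ := ex φ) h

theorem isModel_exs : ∀ {n : ℕ} {φ : InfFormula.{u, v, x} L n},
    φ.exs.IsModel M ↔ ∃ a : Fin n → M, φ.Realize a
  | 0, φ => ⟨fun h => ⟨_, h⟩, fun ⟨a, h⟩ => by
      rwa [Subsingleton.elim a Fin.elim0] at h⟩
  | n + 1, φ => by
    refine (isModel_exs (φ := ex φ)).trans ⟨fun ⟨a, b, h⟩ => ⟨_, h⟩, fun ⟨a, h⟩ => ?_⟩
    refine ⟨Fin.init a, a (Fin.last n), ?_⟩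
    rwa [Fin.snoc_init_self]

/-- Universal quantification over all free variables. -/
def alls (φ : InfFormula.{u, v, x} L n) : InfSentence.{u, v, x} L :=
  neg (exs (neg φ))

theorem isLOmegaOneOmega_alls {φ : InfFormula.{u, v, x} L n} (h : φ.IsLOmegaOneOmega) :
    φ.alls.IsLOmegaOneOmega :=
  isLOmegaOneOmega_exs (φ := neg φ) h

theorem isModel_alls {φ : InfFormula.{u, v, x} L n} :
    φ.alls.IsModel M ↔ ∀ a : Fin n → M, φ.Realize a := by
  have h := not_congr (isModel_exs (M := M) (φ := neg φ))
  simp only [Realize, not_exists, not_not] at h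
  exact h

open Classical in
/-- The formula `φ` or its negation, according to the truth value of `P`. -/
noncomputable def literal (P : Prop) (φ : InfFormula.{u, v, x} L n) : InfFormula.{u, v, x} L n :=
  if P then φ else neg φ

theorem isLOmegaOneOmega_literal {P : Prop} {φ : InfFormula.{u, v, x} L n}
    (h : φ.IsLOmegaOneOmega) : (literal P φ).IsLOmegaOneOmega := by
  unfold literal
  split
  exacts [h, h]

theorem realize_literal {P : Prop} {φ : InfFormula.{u, v, x} L n} {v : Fin n → M} :
    (literal P φ).Realize v ↔ (P ↔ φ.Realize v) := by
  unfold literal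
  split <;> simp_all [Realize]

end Connectives

section Diagram

variable [Countable L.Symbols] {n : ℕ} {M : Type w} [L.Structure M] {N : Type w'} [L.Structure N]

/-- The quantifier-free type of a tuple, as a single formula. -/
noncomputable def diagram (a : Fin n → M) : InfFormula.{u, v, x} L n :=
  countableConj fun b : Bool => if b then
    countableConj fun t : L.Term (Fin n) × L.Term (Fin n) =>
      literal ((equal t.1 t.2 : InfFormula.{u, v, x} L n).Realize a) (equal t.1 t.2)
  else
    countableConj fun R : Σ l, L.Relations l =>
      countableConj fun ts : Fin R.1 → L.Term (Fin n) =>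
        literal ((rel R.2 ts : InfFormula.{u, v, x} L n).Realize a) (rel R.2 ts)

theorem isLOmegaOneOmega_diagram (a : Fin n → M) :
    (diagram a : InfFormula.{u, v, x} L n).IsLOmegaOneOmega := by
  refine isLOmegaOneOmega_countableConj fun b => ?_
  split
  · refine isLOmegaOneOmega_countableConj fun t => ?_
    exact isLOmegaOneOmega_literal trivial
  · refine isLOmegaOneOmega_countableConj fun R => ?_
    refine isLOmegaOneOmega_countableConj fun ts => ?_
    exact isLOmegaOneOmega_literal trivial

theorem realize_diagram {a : Fin n → M} {b : Fin n → N} :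
    (diagram a : InfFormula.{u, v, x} L n).Realize b ↔
      (∀ t₁ t₂ : L.Term (Fin n), t₁.realize a = t₂.realize a ↔ t₁.realize b = t₂.realize b) ∧
      ∀ (l : ℕ) (R : L.Relations l) (ts : Fin l → L.Term (Fin n)),
        Structure.RelMap R (fun i => (ts i).realize a) ↔
          Structure.RelMap R (fun i => (ts i).realize b) := by
  simp only [diagram, realize_countableConj, Bool.forall_bool, Bool.false_eq_true, if_true,
    if_false, realize_literal, Realize, Prod.forall, Sigma.forall]
  exact and_comm

theorem realize_diagram_comp_embedding (g : M ↪[L] N) (a : Fin n → M) :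
    (diagram (g ∘ a) : InfFormula.{u, v, x} L n).Realize a := by
  refine realize_diagram.2 ⟨fun t₁ t₂ => ?_, fun l R ts => ?_⟩
  · simp only [HomClass.realize_term, g.injective.eq_iff]
  · simp only [HomClass.realize_term]
    exact g.map_rel R _

/-- Tuples with the same quantifier-free type generate isomorphic substructures. -/
theorem exists_embedding_of_realize_diagram {a : Fin n → M} {b : Fin n → N}
    (h : (diagram a : InfFormula.{u, v, x} L n).Realize b) :
    Nonempty (Substructure.closure L (Set.range b) ↪[L] M) := by
  obtain ⟨heq, hrel⟩ := realize_diagram.1 h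
  have hterm : ∀ y : Substructure.closure L (Set.range b), ∃ t : L.Term (Fin n),
      t.realize b = y := by
    rintro ⟨y, hy⟩
    obtain ⟨t, rfl⟩ := Substructure.mem_closure_iff_exists_term.1 hy
    -- The variables of `t` are elements of the range of `b`; each is replaced by an index mapping
    -- to it.
    refine ⟨t.relabel fun s => s.2.choose, ?_⟩
    rw [Term.realize_relabel]
    congr 1
    funext s
    exact s.2.choose_spec
  choose t ht using hterm
  -- The choice of terms is harmless: by `heq`, terms equal at `b` are equal at `a`.
  refine ⟨⟨⟨fun y => (t y).realize a, fun y z hyz => ?_⟩, fun {l} F y => ?_, fun {l} R y => ?_⟩⟩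
  · rw [Subtype.ext_iff, ← ht y, ← ht z]
    exact (heq _ _).1 hyz
  · refine (heq _ (.func F fun i => t (y i))).2 ?_
    simp only [Term.realize_func, ht]
    rfl
  · refine (hrel l R fun i => t (y i)).trans ?_
    simp only [ht]
    rfl

end Diagram

/-- The formula saying that the free variables take distinct values. -/
noncomputable def distinct (L : Language.{u, v}) (n : ℕ) : InfFormula.{u, v, x} L n :=
  countableConj fun p : {p : Fin n × Fin n // p.1 ≠ p.2} =>
    neg (equal (.var p.1.1) (.var p.1.2))

theorem isLOmegaOneOmega_distinct (n : ℕ) :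
    (distinct L n : InfFormula.{u, v, x} L n).IsLOmegaOneOmega :=
  isLOmegaOneOmega_countableConj fun _ => trivial

theorem realize_distinct {n : ℕ} {M : Type w} [L.Structure M] {a : Fin n → M} :
    (distinct L n : InfFormula.{u, v, x} L n).Realize a ↔ Function.Injective a := by
  simp only [distinct, realize_countableConj, Realize, Term.realize_var, Subtype.forall,
    Prod.forall, ne_eq]
  exact forall₂_congr fun i j => not_imp_not

end InfFormula

/-! ### The axiomatizing sentence -/

/-- The sentence saying that the universe is infinite and that all quantifier-free types of finite
tuples are realized in `M`. -/
noncomputable def infiniteWithTypesOf [Countable L.Symbols] (M : Type w) [Countable M]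
    [L.Structure M] : InfSentence.{u, v, x} L :=
  .countableConj fun n : ℕ => .countableConj fun b : Bool =>
    if b then (InfFormula.distinct L n).exs
    else (InfFormula.countableDisj fun a : Fin n → M => .diagram a).alls

section

variable [Countable L.Symbols]

theorem isLOmegaOneOmega_infiniteWithTypesOf (M : Type w) [Countable M] [L.Structure M] :
    (infiniteWithTypesOf M : InfSentence.{u, v, x} L).IsLOmegaOneOmega := by
  refine InfFormula.isLOmegaOneOmega_countableConj fun n =>
    InfFormula.isLOmegaOneOmega_countableConj fun b => ?_
  cases b
  · exact InfFormula.isLOmegaOneOmega_alls (InfFormula.isLOmegaOneOmega_countableDisj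
      fun a => InfFormula.isLOmegaOneOmega_diagram a)
  · exact InfFormula.isLOmegaOneOmega_exs (InfFormula.isLOmegaOneOmega_distinct n)

theorem isModel_infiniteWithTypesOf {M : Type w} [Countable M] [L.Structure M]
    {N : Type w'} [L.Structure N] :
    (infiniteWithTypesOf M : InfSentence.{u, v, x} L).IsModel N ↔
      Infinite N ∧ ∀ (n : ℕ) (b : Fin n → N), ∃ a : Fin n → M,
        (InfFormula.diagram a : InfFormula.{u, v, x} L n).Realize b := by
  have h : (infiniteWithTypesOf M : InfSentence.{u, v, x} L).IsModel N ↔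
      ∀ n : ℕ, (InfFormula.countableDisj fun a : Fin n → M =>
          (.diagram a : InfFormula.{u, v, x} L n)).alls.IsModel N ∧
        (InfFormula.distinct L n : InfFormula.{u, v, x} L n).exs.IsModel N := by
    simp only [infiniteWithTypesOf, InfSentence.IsModel, InfFormula.realize_countableConj,
      Bool.forall_bool, if_true, Bool.false_eq_true, if_false]
  simp only [h, InfFormula.isModel_alls, InfFormula.isModel_exs, InfFormula.realize_countableDisj,
    InfFormula.realize_distinct, forall_and]
  rw [and_comm]
  refine and_congr_left fun _ => ⟨fun h => ?_, fun h n => ?_⟩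
  · by_contra hN
    rw [not_infinite_iff_finite] at hN
    have := Fintype.ofFinite N
    obtain ⟨a, ha⟩ := h (Fintype.card N + 1)
    have := Fintype.card_le_of_injective a ha
    simp at this
  · exact ⟨_, (Fin.valEmbedding.trans (Infinite.natEmbedding N)).injective⟩

/-- In a model of the sentence, each substructure generated by a nonempty finite set embeds in `M`,
hence lies in `K`, and these determine membership. Conversely, a tuple in an infinite member of `K`
lies in a countably infinite substructure, which is isomorphic to `M`. -/
theorem IsUniversalClass.isModel_infiniteWithTypesOf_iff (hK : IsUniversalClass K)
    (hcat : IsCategoricalIn K ℵ₀) {M : Bundled.{w} L.Structure} [Countable M]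
    (hM : M ∈ countablyInfiniteMembers K) (N : Bundled.{w} L.Structure) :
    (infiniteWithTypesOf M : InfSentence.{u, v, x} L).IsModel N ↔ N ∈ K ∧ ℵ₀ ≤ #N := by
  rw [isModel_infiniteWithTypesOf, infinite_iff]
  constructor
  · rintro ⟨hN, h⟩
    have : Infinite N := infinite_iff.2 hN
    refine ⟨hK.mem_of_forall_closure_mem fun X hX hX' => ?_, hN⟩
    have := hX.to_subtype
    obtain ⟨n, b, hb⟩ : ∃ n, ∃ b : Fin n → N, Set.range b = X := by
      obtain ⟨n, ⟨e⟩⟩ := Finite.exists_equiv_fin X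
      exact ⟨n, (↑) ∘ e.symm, by simp⟩
    obtain ⟨a, ha⟩ := h n b
    obtain ⟨g⟩ := InfFormula.exists_embedding_of_realize_diagram ha
    rw [hb] at g
    have hne : Nonempty (Substructure.closure L X) :=
      ⟨⟨hX'.some, Substructure.subset_closure hX'.some_mem⟩⟩
    exact hK.mem_of_embedding (M := ⟨Substructure.closure L X, _⟩) hM.1 g
  · rintro ⟨hNK, hN⟩
    refine ⟨hN, fun n b => ?_⟩
    obtain ⟨S, hbS, hS⟩ := hK.exists_countable_substructure hNK hN (Set.range b)
      (Set.countable_range b)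
    obtain ⟨e⟩ := hcat.2 _ hS.1 M hM.1 hS.2 hM.2
    let b' : Fin n → S := fun i => ⟨b i, hbS ⟨i, rfl⟩⟩
    refine ⟨e ∘ b', ?_⟩
    -- The types of `e ∘ b'` and of `b` are compared through `b'`, since embeddings preserve
    -- quantifier-free types.
    have h := (InfFormula.realize_diagram.1
      (InfFormula.realize_diagram_comp_embedding.{u, v, w, w, x} e.toEmbedding b'))
    have h' := InfFormula.realize_diagram.1
      (InfFormula.realize_diagram_comp_embedding.{u, v, w, w, x} S.subtype b')
    exact InfFormula.realize_diagram.2 ⟨fun t₁ t₂ => (h.1 t₁ t₂).trans (h'.1 t₁ t₂).symm,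
      fun l R ts => (h.2 l R ts).trans (h'.2 l R ts).symm⟩

end

end FirstOrder.Language


theorem lemma3p1 {L : FirstOrder.Language.{u, v}} (hL : Countable L.Symbols)
    (K : Set (Bundled.{w} L.Structure)) (hK : Language.IsUniversalClass K)
    (hcat : Language.IsCategoricalIn K Cardinal.aleph0) :
    (∀ M ∈ K, ∀ N ∈ K, Cardinal.aleph0 ≤ Cardinal.mk M → Cardinal.aleph0 ≤ Cardinal.mk N →
      ∀ f : M → N,
        Language.IsSubstructureMap L f ↔ Language.IsInfElementaryMap.{u, v, w, w, x} L f) ∧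
    (∃ φ : Language.InfSentence.{u, v, x} L,
      φ.IsLOmegaOneOmega ∧
      (∀ M : Bundled.{w} L.Structure, φ.IsModel M ↔ M ∈ K ∧ Cardinal.aleph0 ≤ Cardinal.mk M) ∧
      ∀ M ∈ K, Cardinal.mk M = Cardinal.aleph0 → φ.IsScottSentenceOf M) := by
  constructor
  · refine fun M hM N hN hM' hN' f => ⟨?_, fun h => h.isSubstructureMap⟩
    rintro ⟨g, rfl⟩ n φ a
    exact hK.realize_comp_embedding hcat φ M hM N hN hM' hN' g a
  · obtain ⟨M₀, hM₀, hcard₀⟩ := hcat.1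
    have : Countable M₀ := Cardinal.mk_le_aleph0_iff.1 hcard₀.le
    have hmod := hK.isModel_infiniteWithTypesOf_iff.{u, v, w, x} hcat ⟨hM₀, hcard₀⟩
    refine ⟨_, Language.isLOmegaOneOmega_infiniteWithTypesOf M₀, hmod, fun M hM hcard N => ?_⟩
    rw [hmod N]
    -- A countable model of the sentence is a countably infinite member of `K`, so categoricity
    -- identifies it with `M`.
    constructor
    · rintro ⟨_, hN, hN'⟩
      exact hcat.2 N hN M hM ((Cardinal.mk_le_aleph0_iff.2 ‹_›).antisymm hN') hcard
    · rintro ⟨e⟩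
      have hN : Cardinal.mk N = Cardinal.aleph0 := (Cardinal.mk_congr e.toEquiv).trans hcard
      exact ⟨Cardinal.mk_le_aleph0_iff.1 hN.le, hK.iso_mem M N hM ⟨e.symm⟩, hN.ge⟩
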